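/- Write $\mathrm{PV}\int_{\mathbb R^2} g(y)\,dy=\lim_{r\to0^+,\,R\to\infty}\int_{r<|y|<R}g(y)\,dy$. Let $k\ge 4$ be an integer, $f_0\in H^k(\mathbb R^2)$ real-valued, $\alpha\in[0,1)$, $\varepsilon\in(0,1+\alpha)$ and $T>0$. Let $f\in C^1([0,T];H^k(\mathbb R^2))$ be a real-valued solution on $[0,T]$ of the generalised $\alpha$-Muskat problem $$\frac{\partial f}{\partial t}(x,t)=\mathrm{PV}\int_{\mathbb R^2}\frac{\big(\nabla f(x,t)-\nabla f(x-y,t)\big)\cdot y}{\big[|y|^2+(f(x,t)-f(x-y,t))^2\big]^{\frac{3+\alpha}{2}}}\,dy,\qquad f(x,0)=f_0(x),$$ for all $x\in\mathbb R^2$ and $t\in[0,T]$ (with one-sided time derivatives at the endpoints), where $f_0$ and $f(\cdot,t)$ are identified with their continuous representatives. Suppose that $$\|\nabla f_0\|_{L^\infty}<\sqrt{\frac{1+\alpha-\varepsilon}{5+\alpha+\varepsilon}}.$$ Then, for all $t\in[0,T]$, $$\|\nabla f(\cdot,t)\|_{L^\infty}\le\|\nabla f_0\|_{L^\infty}.$$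 -/

import Mathlib

open MeasureTheory Set Filter Topology
open scoped Gradient

noncomputable section

namespace Muskat

/-- The plane `ℝ²` with its Euclidean norm. -/
abbrev Plane : Type := EuclideanSpace ℝ (Fin 2)

/-- The real function `φ` on the plane belongs to the Sobolev space `H^k(ℝ²)`:
it is square integrable, and the tempered distribution that it defines is in `H^k = H^{k,2}`. -/
def MemH (k : ℕ) (φ : Plane → ℝ) : Prop :=
  ∃ u : Lp ℂ 2 (volume : Measure Plane), (u =ᵐ[volume] fun x => (φ x : ℂ)) ∧
    TemperedDistribution.MemSobolev (k : ℝ) 2 (u : TemperedDistribution Plane ℂ)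

/-- `F ∈ L²` is the Bessel potential of order `k` of `φ ∈ L²`, that is,
`F = 𝓕⁻¹ ((1 + |ξ|²)^(k/2) 𝓕 φ)`. So `φ ∈ H^k` exactly when such an `F` exists, and `φ ↦ F` is an
isometry of `H^k` into `L²`, where the norm of `H^k` is `‖(1 + |ξ|²)^(k/2) 𝓕 φ‖_{L²}`. -/
def IsBesselPotential (k : ℕ) (φ : Plane → ℝ) (F : Lp ℂ 2 (volume : Measure Plane)) : Prop :=
  ∃ u : Lp ℂ 2 (volume : Measure Plane), (u =ᵐ[volume] fun x => (φ x : ℂ)) ∧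
    TemperedDistribution.besselPotential Plane ℂ (k : ℝ) (u : TemperedDistribution Plane ℂ)
      = (F : TemperedDistribution Plane ℂ)

/-- `f ∈ C¹([0,T]; H^k(ℝ²))`. Since the Bessel potential of order `k` is an isometry of `H^k`
onto `L²`, this says that `t ↦ (Bessel potential of f(·,t))` is a `C¹` curve in `L²`. -/
def IsC1Curve (k : ℕ) (T : ℝ) (f : ℝ → Plane → ℝ) : Prop :=
  ∃ F : ℝ → Lp ℂ 2 (volume : Measure Plane),
    ContDiffOn ℝ 1 F (Icc 0 T) ∧ ∀ t ∈ Icc 0 T, IsBesselPotential k (f t) (F t)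

/-- The principal value integral `PV ∫_{ℝ²} g(y) dy` exists and equals `v`: the integrals over the
annuli `r < |y| < R` converge to `v` as `r → 0⁺` and `R → ∞`. -/
def HasPV (g : Plane → ℝ) (v : ℝ) : Prop :=
  (∀ r R : ℝ, 0 < r → IntegrableOn g {y | r < ‖y‖ ∧ ‖y‖ < R}) ∧
    Tendsto (fun p : ℝ × ℝ => ∫ y in {y : Plane | p.1 < ‖y‖ ∧ ‖y‖ < p.2}, g y)
      (𝓝[>] 0 ×ˢ atTop) (𝓝 v)

/-- The integrand `y ↦ (∇φ(x) - ∇φ(x-y)) · y / [|y|² + (φ(x) - φ(x-y))²]^((3+α)/2)` of the contour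
equation. -/
def contourIntegrand (α : ℝ) (φ : Plane → ℝ) (x y : Plane) : ℝ :=
  inner ℝ (∇ φ x - ∇ φ (x - y)) y /
    (‖y‖ ^ 2 + (φ x - φ (x - y)) ^ 2) ^ ((3 + α) / 2)

/-- `f` is a solution on `[0,T]`, in the class `C¹([0,T]; H^k(ℝ²))`, of the generalised `α`-Muskat
problem with initial datum `f₀`. As usual `f(·,t) ∈ H^k` stands for its continuous representative.
At `t = 0` and `t = T` the time derivative is one-sided. -/
structure IsSolution (α : ℝ) (k : ℕ) (T : ℝ) (f₀ : Plane → ℝ) (f : ℝ → Plane → ℝ) : Prop where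
  c1_curve : IsC1Curve k T f
  continuous : ∀ t ∈ Icc 0 T, Continuous (f t)
  equation : ∀ t ∈ Icc 0 T, ∀ x : Plane, ∃ v : ℝ,
    HasDerivWithinAt (fun s => f s x) v (Icc 0 T) t ∧ HasPV (contourIntegrand α (f t) x) v
  initial : f 0 = f₀

end Muskat

end

/-! The Lipschitz bound is propagated through the increments `f(x+ξ,t) - f(x,t)`, by a maximum
principle for each fixed `ξ`. Where an increment is maximal in `x`, put `z = x+ξ`: the gradients at
`z` and `x` agree, and `φ(z) - φ(z-y) ≥ φ(x) - φ(x-y)` for every `y`, so all chord slopes from `z`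
dominate those from `x`.

In polar coordinates `y = ρω`, integration by parts in `ρ` removes the gradient at `x-y` and leaves
`ρ^(-1-α)` times a function of the chord slope `u` and of the radial slope `a = ∇φ(x)·ω`. By
`antitoneOn_slopeKernel` this function decreases in `u` as long as slopes are at most `L` with
`(5+α)L² ≤ 1+α`. The outer boundary term has a good sign and the inner one is `O(r^(1-α))`, so the
right-hand side at `z` is at most that at `x` (`pv_le_pv`) and the maximal increment cannot grow
(`IsSolution.increment_le`).

The monotonicity presupposes a gradient bound at later times. Since the initial inequality is
strict, a slightly larger slope `Λ` is still admissible, and time continuity gives the bound `Λ` for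
a short while; the increments then restore the bound `L`. Continuous induction
(`IsSolution.norm_gradient_le`) covers `[0,T]`. The regularity used comes from
`IsBesselPotential.sobolev`. -/

namespace Muskat

/-! ### Sobolev embedding in the plane via the Fourier transform. -/

section Sobolev

open scoped FourierTransform SchwartzMap ContDiff

theorem IsBesselPotential.sub {k : ℕ} {φ ψ : Plane → ℝ} {F G : Lp ℂ 2 (volume : Measure Plane)}
    (hφ : IsBesselPotential k φ F) (hψ : IsBesselPotential k ψ G) :
    IsBesselPotential k (fun x => φ x - ψ x) (F - G) := by
  obtain ⟨u, hu, hF⟩ := hφ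
  obtain ⟨v, hv, hG⟩ := hψ
  refine ⟨u - v, ?_, ?_⟩
  · filter_upwards [hu, hv, Lp.coeFn_sub u v] with x h1 h2 h3
    rw [h3, Pi.sub_apply, h1, h2]
    push_cast
    rfl
  · rw [← Lp.toTemperedDistributionCLM_apply, ← Lp.toTemperedDistributionCLM_apply] at *
    rw [map_sub, map_sub, map_sub, hF, ← hG]

/-- The weight `(1 + |ξ|²)⁻¹`, which is square integrable in the plane. -/
noncomputable def japaneseWeight (ξ : Plane) : ℝ := (1 + ‖ξ‖ ^ 2)⁻¹

theorem memLp_japaneseWeight : MemLp japaneseWeight 2 (volume : Measure Plane) := by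
  have hc : Continuous japaneseWeight := by
    unfold japaneseWeight
    exact Continuous.inv₀ (by fun_prop) (fun x => by positivity)
  rw [memLp_two_iff_integrable_sq hc.aestronglyMeasurable]
  have h := integrable_rpow_neg_one_add_norm_sq (E := Plane) (μ := volume) (r := 4) (by simp; norm_num)
  refine h.congr (ae_of_all _ fun x => ?_)
  have : (-4 / 2 : ℝ) = -((2 : ℕ) : ℝ) := by norm_num
  simp only [japaneseWeight]
  rw [this, Real.rpow_neg (by positivity), Real.rpow_natCast, inv_pow]

theorem integral_japaneseWeight_mul_norm_le (G : Lp ℂ 2 (volume : Measure Plane)) :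
    Integrable (fun ξ => japaneseWeight ξ * ‖G ξ‖) ∧
    ∫ ξ, japaneseWeight ξ * ‖G ξ‖ ≤ (eLpNorm japaneseWeight 2 volume).toReal * ‖G‖ := by
  have hG := Lp.memLp G
  have hi : Integrable (fun ξ => japaneseWeight ξ * ‖G ξ‖) :=
    memLp_japaneseWeight.integrable_mul hG.norm
  refine ⟨hi, ?_⟩
  have h0 : ∀ ξ : Plane, 0 ≤ japaneseWeight ξ := fun ξ => by unfold japaneseWeight; positivity
  have h1 : ∫ ξ, japaneseWeight ξ * ‖G ξ‖
      = (eLpNorm (fun ξ => japaneseWeight ξ • ‖G ξ‖) 1 volume).toReal := by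
    simp only [smul_eq_mul]
    rw [eLpNorm_one_eq_lintegral_enorm, ← integral_norm_eq_lintegral_enorm hi.1]
    refine integral_congr_ae (ae_of_all _ fun ξ => ?_)
    simp [abs_of_nonneg (h0 ξ)]
  rw [h1, Lp.norm_def, ← eLpNorm_norm G, ← ENNReal.toReal_mul]
  refine ENNReal.toReal_mono ?_ ?_
  · exact ENNReal.mul_ne_top memLp_japaneseWeight.2.ne hG.norm.2.ne
  · exact eLpNorm_smul_le_mul_eLpNorm (p := 2) (q := 2) (r := 1) (φ := japaneseWeight)
      (f := fun ξ => ‖G ξ‖) hG.norm.1 memLp_japaneseWeight.1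

/-- The inverse Fourier transform of an `L¹` function that represents `𝓕 u` represents `u`. -/
theorem ae_eq_fourierInv_of_fourier_eq (u : Lp ℂ 2 (volume : Measure Plane)) {v : Plane → ℂ}
    (hv : Integrable v)
    (h : ∀ ψ : 𝓢(Plane, ℂ), 𝓕 (u : TemperedDistribution Plane ℂ) ψ = ∫ ξ, ψ ξ • v ξ) :
    u =ᵐ[volume] 𝓕⁻ v := by
  have hvn : Integrable (fun ξ => v (-ξ)) := hv.comp_neg
  have hcont : Continuous (𝓕⁻ v) := by
    rw [Real.fourierInv_eq_fourier_comp_neg]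
    exact VectorFourier.fourierIntegral_continuous Real.continuous_fourierChar
      (by exact continuous_inner) hvn
  refine ae_eq_of_integral_contDiff_smul_eq ((Lp.memLp u).locallyIntegrable (by norm_num))
    hcont.locallyIntegrable fun g hg hgc => ?_
  have hg₁ : HasCompactSupport (Complex.ofRealCLM ∘ g) := hgc.comp_left rfl
  have hg₂ : ContDiff ℝ ∞ (Complex.ofRealCLM ∘ g) := by fun_prop
  set ψ : 𝓢(Plane, ℂ) := hg₁.toSchwartzMap hg₂ with hψ
  -- Testing against `𝓕⁻ ψ` turns the left side into `∫ ψ u`; on the right, Fubini moves `𝓕⁻` from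
  -- `ψ` to `v`.
  have h1 := h (𝓕⁻ ψ)
  rw [TemperedDistribution.fourier_apply, FourierTransform.fourier_fourierInv_eq,
    Lp.toTemperedDistribution_apply] at h1
  have h2 : ∫ ξ, (𝓕⁻ ψ) ξ • v ξ = ∫ x, ψ x • (𝓕⁻ v) x := by
    rw [SchwartzMap.fourierInv_coe]
    have := VectorFourier.integral_fourierIntegral_smul_eq_flip (L := innerₗ Plane) (μ := volume)
      (ν := volume) Real.continuous_fourierChar continuous_inner ψ.integrable hvn
    rw [Real.fourierInv_eq_fourier_comp_neg v, ← integral_neg_eq_self]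
    simp only [Real.fourierInv_eq_fourier_neg, neg_neg]
    rw [flip_innerₗ] at this
    exact this
  rw [h2] at h1
  simpa [hψ] using h1

/-- With `k ≥ 4`, two powers of `|ξ|` can be spent on derivatives and the remaining factor
`(1+|ξ|²)^(1-k/2) ≤ (1+|ξ|²)⁻¹` is still in `L²(ℝ²)`; Cauchy–Schwarz then gives the weighted `L¹`
bound. It is linear in `‖F‖`, so applied to differences of time slices it yields continuity in time
uniformly in space. -/
theorem IsBesselPotential.exists_fourier {k : ℕ} (hk : 4 ≤ k) {φ : Plane → ℝ} (hφ : Continuous φ)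
    {F : Lp ℂ 2 (volume : Measure Plane)} (h : IsBesselPotential k φ F) :
    ∃ w : Plane → ℂ, AEStronglyMeasurable w ∧ Integrable (fun ξ => (1 + ‖ξ‖ ^ 2) * ‖w ξ‖) ∧
      (∀ x, φ x = (𝓕 w x).re) ∧
      ∫ ξ, (1 + ‖ξ‖ ^ 2) * ‖w ξ‖ ≤ (eLpNorm japaneseWeight 2 volume).toReal * ‖F‖ := by
  obtain ⟨u, hu, hF⟩ := h
  set m : Plane → ℂ := fun ξ => ((1 + ‖ξ‖ ^ 2) ^ (-(k : ℝ) / 2) : ℝ) with hm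
  set G : Lp ℂ 2 (volume : Measure Plane) := 𝓕 F with hG
  set v : Plane → ℂ := fun ξ => m ξ * G ξ with hv
  have hmt : m.HasTemperateGrowth := by rw [hm]; fun_prop
  have hmc : Continuous m := hmt.1.continuous
  have hvm : AEStronglyMeasurable v := hmc.aestronglyMeasurable.mul (Lp.memLp G).1
  have hbound : ∀ ξ, (1 + ‖ξ‖ ^ 2) * ‖v ξ‖ ≤ japaneseWeight ξ * ‖G ξ‖ := by
    intro ξ
    have h1 : (1 : ℝ) ≤ 1 + ‖ξ‖ ^ 2 := by nlinarith [sq_nonneg ‖ξ‖]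
    have h2 : (1 + ‖ξ‖ ^ 2) ^ (-(k : ℝ) / 2) ≤ (1 + ‖ξ‖ ^ 2) ^ (-(2 : ℕ) : ℝ) := by
      apply Real.rpow_le_rpow_of_exponent_le h1
      have : (4 : ℝ) ≤ k := by exact_mod_cast hk
      push_cast; linarith
    rw [Real.rpow_neg (by positivity), Real.rpow_natCast] at h2
    have h3 : ‖m ξ‖ = (1 + ‖ξ‖ ^ 2) ^ (-(k : ℝ) / 2) := by
      rw [hm, Complex.norm_real, Real.norm_eq_abs, abs_of_nonneg (by positivity)]
    rw [hv, norm_mul, h3, ← mul_assoc]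
    gcongr
    calc _ ≤ (1 + ‖ξ‖ ^ 2) * ((1 + ‖ξ‖ ^ 2) ^ 2)⁻¹ := by gcongr
      _ = _ := by rw [japaneseWeight]; field_simp
  obtain ⟨hi, hI⟩ := integral_japaneseWeight_mul_norm_le G
  have hint : Integrable (fun ξ => (1 + ‖ξ‖ ^ 2) * ‖v ξ‖) := by
    refine hi.mono' (AEStronglyMeasurable.mul (by fun_prop) hvm.norm) (ae_of_all _ fun ξ => ?_)
    rw [Real.norm_eq_abs, abs_of_nonneg (by positivity)]
    exact hbound ξ
  have hvi : Integrable v := by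
    refine hint.mono' hvm (ae_of_all _ fun ξ => ?_)
    nlinarith [norm_nonneg (v ξ), sq_nonneg ‖ξ‖]
  have hpair : ∀ ψ : 𝓢(Plane, ℂ), 𝓕 (u : TemperedDistribution Plane ℂ) ψ = ∫ ξ, ψ ξ • v ξ := by
    intro ψ
    have h1 : (u : TemperedDistribution Plane ℂ)
        = TemperedDistribution.besselPotential Plane ℂ (-(k : ℝ)) F :=
      ((TemperedDistribution.besselPotential_neg_apply_eq_iff _ _ _).2 hF).symm
    rw [h1, TemperedDistribution.fourier_besselPotential_eq_smulLeftCLM_fourier_apply,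
      Lp.fourier_toTemperedDistribution_eq, TemperedDistribution.smulLeftCLM_apply_apply,
      Lp.toTemperedDistribution_apply]
    refine integral_congr_ae (ae_of_all _ fun ξ => ?_)
    have h2 := SchwartzMap.smulLeftCLM_apply_apply hmt ψ ξ
    simp only [hv, hG, smul_eq_mul, hm] at h2 ⊢
    rw [h2]
    ring
  have hae := ae_eq_fourierInv_of_fourier_eq u hvi hpair
  rw [Real.fourierInv_eq_fourier_comp_neg] at hae
  have hcont : Continuous (𝓕 fun ξ => v (-ξ)) :=
    VectorFourier.fourierIntegral_continuous Real.continuous_fourierChar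
      (by exact continuous_inner) hvi.comp_neg
  have heq : (fun x => (φ x : ℂ)) = 𝓕 fun ξ => v (-ξ) :=
    Measure.eq_of_ae_eq (μ := volume) (hu.symm.trans hae) (by fun_prop) hcont
  refine ⟨fun ξ => v (-ξ), hvi.comp_neg.1, ?_, fun x => ?_, ?_⟩
  · simpa using hint.comp_neg
  · rw [← heq]; simp
  · have := integral_neg_eq_self (fun ξ => (1 + ‖ξ‖ ^ 2) * ‖v ξ‖) (volume : Measure Plane)
    simp only [norm_neg] at this
    rw [this]
    refine (integral_mono hint hi hbound).trans (hI.trans ?_)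
    rw [hG, Lp.norm_fourier_eq]

theorem norm_fourier_le_integral {E : Type*} [NormedAddCommGroup E] [NormedSpace ℂ E]
    (w : Plane → E) (x : Plane) : ‖𝓕 w x‖ ≤ ∫ ξ, ‖w ξ‖ :=
  VectorFourier.norm_fourierIntegral_le_integral_norm _ _ (innerₗ Plane) w x

theorem norm_fourierSMulRight_innerSL {E : Type*} [NormedAddCommGroup E] [NormedSpace ℂ E]
    (w : Plane → E) (ξ : Plane) :
    ‖VectorFourier.fourierSMulRight (innerSL ℝ) w ξ‖ = 2 * Real.pi * ‖ξ‖ * ‖w ξ‖ := by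
  rw [VectorFourier.norm_fourierSMulRight, innerSL_apply_norm]

theorem lipschitz_fourier {E : Type*} [NormedAddCommGroup E] [NormedSpace ℂ E]
    {w : Plane → E} (hw : Integrable w) (hw' : Integrable fun ξ => ‖ξ‖ * ‖w ξ‖) (x y : Plane) :
    ‖𝓕 w x - 𝓕 w y‖ ≤ (∫ ξ, 2 * Real.pi * ‖ξ‖ * ‖w ξ‖) * ‖x - y‖ := by
  refine Convex.norm_image_sub_le_of_norm_hasFDerivWithin_le (s := univ) (𝕜 := ℝ)
    (fun z _ => (Real.hasFDerivAt_fourier hw hw' z).hasFDerivWithinAt) (fun z _ => ?_)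
    convex_univ (mem_univ y) (mem_univ x)
  refine (norm_fourier_le_integral _ z).trans_eq ?_
  simp only [norm_fourierSMulRight_innerSL]

/-- Sobolev embedding: `H^k(ℝ²) ⊂ C^{1,1}` for `k ≥ 4`, with uniform control of the function and
of its gradient, and decay at infinity. -/
theorem IsBesselPotential.sobolev {k : ℕ} (hk : 4 ≤ k) {φ : Plane → ℝ} (hφ : Continuous φ)
    {F : Lp ℂ 2 (volume : Measure Plane)} (h : IsBesselPotential k φ F) :
    Differentiable ℝ φ ∧ Tendsto φ (cocompact Plane) (𝓝 0) ∧
    (∃ K, 0 ≤ K ∧ ∀ x y, ‖∇ φ x - ∇ φ y‖ ≤ K * ‖x - y‖) ∧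
    (∀ x, |φ x| ≤ 2 * Real.pi * (eLpNorm japaneseWeight 2 volume).toReal * ‖F‖) ∧
    (∀ x, ‖∇ φ x‖ ≤ 2 * Real.pi * (eLpNorm japaneseWeight 2 volume).toReal * ‖F‖) := by
  obtain ⟨w, hwm, hwi, hw, hwF⟩ := h.exists_fourier hk hφ
  have h0 : Integrable w := by
    refine hwi.mono' hwm (ae_of_all _ fun ξ => ?_)
    nlinarith [norm_nonneg (w ξ), sq_nonneg ‖ξ‖]
  have h1 : Integrable fun ξ => ‖ξ‖ * ‖w ξ‖ := by
    refine hwi.mono' (AEStronglyMeasurable.mul (by fun_prop) hwm.norm) (ae_of_all _ fun ξ => ?_)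
    rw [Real.norm_eq_abs, abs_of_nonneg (by positivity)]
    gcongr
    nlinarith [sq_nonneg (‖ξ‖ - 1)]
  -- `𝓕 W` is the derivative of `𝓕 w`, and `‖W ξ‖ = 2π‖ξ‖‖w ξ‖`; the same Lipschitz estimate applied
  -- to `W` bounds the variation of the gradient.
  set W := VectorFourier.fourierSMulRight (innerSL ℝ) w with hW
  have hWm : AEStronglyMeasurable W := hwm.fourierSMulRight
  have hW0 : Integrable W := by
    refine (h1.const_mul (2 * Real.pi)).mono' hWm (ae_of_all _ fun ξ => ?_)
    rw [hW, norm_fourierSMulRight_innerSL, mul_assoc]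
  have hW1 : Integrable fun ξ => ‖ξ‖ * ‖W ξ‖ := by
    refine (hwi.const_mul (2 * Real.pi)).mono' (AEStronglyMeasurable.mul (by fun_prop) hWm.norm)
      (ae_of_all _ fun ξ => ?_)
    rw [Real.norm_eq_abs, abs_of_nonneg (by positivity), hW, norm_fourierSMulRight_innerSL]
    have : 0 ≤ 2 * Real.pi * ‖w ξ‖ := by positivity
    nlinarith
  have hd : ∀ x, HasFDerivAt φ (Complex.reCLM ∘L (𝓕 W x)) x := by
    intro x
    have := Complex.reCLM.hasFDerivAt.comp x (Real.hasFDerivAt_fourier h0 h1 x)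
    refine this.congr_of_eventuallyEq (Eventually.of_forall fun y => ?_)
    simp [hw y]
  have hgrad : ∀ x, ∇ φ x = (InnerProductSpace.toDual ℝ Plane).symm (Complex.reCLM ∘L (𝓕 W x)) :=
    fun x => by rw [gradient, (hd x).fderiv]
  have hre : ∀ A : Plane →L[ℝ] ℂ, ‖Complex.reCLM ∘L A‖ ≤ ‖A‖ := fun A => by
    refine (ContinuousLinearMap.opNorm_comp_le _ _).trans ?_
    rw [Complex.reCLM_norm, one_mul]
  have hC : (∫ ξ, (1 + ‖ξ‖ ^ 2) * ‖w ξ‖) * (2 * Real.pi)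
      ≤ 2 * Real.pi * (eLpNorm japaneseWeight 2 volume).toReal * ‖F‖ := by
    rw [mul_assoc, mul_comm]; gcongr
  refine ⟨fun x => (hd x).differentiableAt, ?_, ⟨∫ ξ, 2 * Real.pi * ‖ξ‖ * ‖W ξ‖, ?_, ?_⟩, ?_, ?_⟩
  -- Decay at infinity is the Riemann–Lebesgue lemma.
  · have := (Complex.continuous_re.tendsto 0).comp (tendsto_integral_exp_inner_smul_cocompact w)
    rw [Complex.zero_re] at this
    exact this.congr fun x => (hw x).symm
  · exact integral_nonneg fun ξ => by positivity
  · intro x y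
    rw [hgrad, hgrad, ← map_sub, LinearIsometryEquiv.norm_map, ← ContinuousLinearMap.comp_sub]
    exact (hre _).trans (lipschitz_fourier hW0 hW1 x y)
  · intro x
    rw [hw x]
    refine (Complex.abs_re_le_norm _).trans ((norm_fourier_le_integral w x).trans (le_trans ?_ hC))
    rw [← integral_mul_const]
    refine integral_mono h0.norm (hwi.mul_const _) fun ξ => ?_
    have h3 := Real.pi_gt_three
    have : 1 ≤ (1 + ‖ξ‖ ^ 2) * (2 * Real.pi) := by nlinarith [sq_nonneg ‖ξ‖]
    have h4 := mul_le_mul_of_nonneg_right this (norm_nonneg (w ξ))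
    simp only
    linarith
  · intro x
    rw [hgrad, LinearIsometryEquiv.norm_map]
    refine (hre _).trans ((norm_fourier_le_integral W x).trans (le_trans ?_ hC))
    rw [← integral_mul_const]
    refine integral_mono hW0.norm (hwi.mul_const _) fun ξ => ?_
    simp only [hW, norm_fourierSMulRight_innerSL]
    have : 0 ≤ 2 * Real.pi * ‖w ξ‖ := by positivity
    nlinarith [sq_nonneg (‖ξ‖ - 1)]

end Sobolev

/-! ### Monotonicity of the kernel in the slope, and comparison along a ray. -/

/-- The primitive `∫₀ᵘ (1 + s²)^(-p) ds`. -/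
noncomputable def slopePrimitive (p u : ℝ) : ℝ := ∫ s in (0 : ℝ)..u, (1 + s ^ 2) ^ (-p)

theorem continuous_one_add_sq_rpow (p : ℝ) : Continuous fun s : ℝ => (1 + s ^ 2) ^ (-p) :=
  Continuous.rpow_const (by fun_prop) fun s => Or.inl (by positivity)

theorem hasDerivAt_slopePrimitive (p u : ℝ) :
    HasDerivAt (slopePrimitive p) ((1 + u ^ 2) ^ (-p)) u :=
  ((continuous_one_add_sq_rpow p).integral_hasStrictDerivAt 0 u).hasDerivAt

theorem monotone_slopePrimitive (p : ℝ) : Monotone (slopePrimitive p) :=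
  monotone_of_deriv_nonneg (fun u => (hasDerivAt_slopePrimitive p u).differentiableAt) fun u => by
    rw [(hasDerivAt_slopePrimitive p u).deriv]; positivity

theorem slopePrimitive_sub_le {p : ℝ} (hp : 0 ≤ p) {u v : ℝ} (huv : u ≤ v) :
    slopePrimitive p v - slopePrimitive p u ≤ v - u := by
  have h : Monotone fun u => u - slopePrimitive p u := by
    refine monotone_of_hasDerivAt_nonneg
      (fun u => (hasDerivAt_id u).sub (hasDerivAt_slopePrimitive p u)) fun u => ?_
    have : (1 + u ^ 2) ^ (-p) ≤ 1 :=
      Real.rpow_le_one_of_one_le_of_nonpos (by nlinarith [sq_nonneg u]) (by linarith)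
    simpa using this
  have := h huv
  simp only at this
  linarith

/-- The kernel of the contour equation in polar form, after the radial derivative has been
integrated by parts: `a` is the radial slope at the base point and `u` that of the chord. -/
noncomputable def slopeKernel (α a u : ℝ) : ℝ :=
  (a - u) * (1 + u ^ 2) ^ (-((3 + α) / 2)) - α * slopePrimitive ((3 + α) / 2) u

/-- This is where the threshold arises: the `u`-derivative is a negative multiple of `1+α - 2u² +
(3+α)ua`, which for `|u|, |a| ≤ L` is at least `1+α - (5+α)L²`. -/
theorem antitoneOn_slopeKernel {α a L : ℝ} (hα : 0 ≤ α) (hL : (5 + α) * L ^ 2 ≤ 1 + α)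
    (ha : |a| ≤ L) : AntitoneOn (slopeKernel α a) (Icc (-L) L) := by
  set p := (3 + α) / 2 with hp
  have hd : ∀ u, HasDerivAt (slopeKernel α a)
      (((0 - 1) * (1 + u ^ 2) ^ (-p) + (a - u) * ((2 * u) * (-p) * (1 + u ^ 2) ^ (-p - 1)))
        - α * (1 + u ^ 2) ^ (-p)) u := by
    intro u
    have h1 : HasDerivAt (fun u : ℝ => 1 + u ^ 2) (2 * u) u := by
      simpa using (hasDerivAt_pow 2 u).const_add 1
    have h2 := h1.rpow_const (p := -p) (Or.inl (by positivity))
    exact (((hasDerivAt_const u a).sub (hasDerivAt_id u)).mul h2).sub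
      ((hasDerivAt_slopePrimitive p u).const_mul α)
  refine antitoneOn_of_deriv_nonpos (convex_Icc _ _)
    (fun u _ => (hd u).continuousAt.continuousWithinAt)
    (fun u _ => (hd u).differentiableAt.differentiableWithinAt) fun u hu => ?_
  rw [(hd u).deriv]
  have hu' := interior_subset hu
  have hua : |u| ≤ L := abs_le.2 hu'
  have h3 : (1 + u ^ 2) ^ (-p) = (1 + u ^ 2) ^ (-p - 1) * (1 + u ^ 2) := by
    rw [← Real.rpow_add_one (by positivity)]; congr 1; ring
  have h4 : 0 ≤ (1 + u ^ 2) ^ (-p - 1) := by positivity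
  have hL0 : 0 ≤ L := (abs_nonneg a).trans ha
  have h5 : -(L * L) ≤ u * a := by
    have := mul_le_mul hua ha (abs_nonneg a) hL0
    rw [← abs_mul] at this
    exact (abs_le.1 this).1
  have h6 : u ^ 2 ≤ L ^ 2 := by rw [← sq_abs]; gcongr
  have h7 : 0 ≤ (1 + α) - 2 * u ^ 2 + (3 + α) * (u * a) := by nlinarith
  rw [h3]
  have : ((0 - 1) * ((1 + u ^ 2) ^ (-p - 1) * (1 + u ^ 2)) +
      (a - u) * (2 * u * -p * (1 + u ^ 2) ^ (-p - 1)) -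
      α * ((1 + u ^ 2) ^ (-p - 1) * (1 + u ^ 2)))
      = -((1 + u ^ 2) ^ (-p - 1) * ((1 + α) - 2 * u ^ 2 + (3 + α) * (u * a))) := by
    rw [hp]; ring
  rw [this]
  exact neg_nonpos.2 (mul_nonneg h4 h7)

/-- Integration by parts along a ray. -/
theorem hasDerivAt_rpow_mul_slopePrimitive {α a g' ρ : ℝ} {g : ℝ → ℝ} (hρ : 0 < ρ)
    (hg : HasDerivAt g g' ρ) :
    HasDerivAt (fun s => s ^ (-α) * slopePrimitive ((3 + α) / 2) (g s / s))
      (ρ ^ (-1 - α) * slopeKernel α a (g ρ / ρ)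
        - ρ ^ 2 * (a - g') / (ρ ^ 2 + g ρ ^ 2) ^ ((3 + α) / 2)) ρ := by
  have h1 : HasDerivAt (fun s : ℝ => s ^ (-α)) (-α * ρ ^ (-α - 1)) ρ :=
    Real.hasDerivAt_rpow_const (Or.inl hρ.ne')
  have h2 : HasDerivAt (fun s => slopePrimitive ((3 + α) / 2) (g s / s))
      ((1 + (g ρ / ρ) ^ 2) ^ (-((3 + α) / 2)) * ((g' * ρ - g ρ * 1) / ρ ^ 2)) ρ :=
    HasDerivAt.comp (h₂ := slopePrimitive ((3 + α) / 2)) ρ (hasDerivAt_slopePrimitive _ _)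
      (hg.div (hasDerivAt_id ρ) hρ.ne')
  refine (h1.mul h2).congr_deriv ?_
  have e1 : ρ ^ 2 + g ρ ^ 2 = ρ ^ 2 * (1 + (g ρ / ρ) ^ 2) := by field_simp
  have e2 : (ρ ^ 2 : ℝ) ^ ((3 + α) / 2) = ρ ^ (3 + α) := by
    rw [← Real.rpow_natCast, ← Real.rpow_mul hρ.le]; congr 1; push_cast; ring
  have e3 : ρ ^ (-α) = ρ ^ (-1 - α) * ρ := by
    rw [← Real.rpow_add_one hρ.ne']; congr 1; ring
  have e4 : ρ ^ (-α - 1) = ρ ^ (-1 - α) := by congr 1; ring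
  have e5 : ρ ^ 2 = ρ ^ (-1 - α) * ρ ^ (3 + α) := by
    rw [← Real.rpow_add hρ, ← Real.rpow_natCast]; congr 1; push_cast; ring
  have e6 : ρ ^ 2 * (a - g') / (ρ ^ 2 + g ρ ^ 2) ^ ((3 + α) / 2)
      = ρ ^ (-1 - α) * (1 + (g ρ / ρ) ^ 2) ^ (-((3 + α) / 2)) * (a - g') := by
    rw [e1, Real.mul_rpow (by positivity) (by positivity), e2, Real.rpow_neg (by positivity)]
    nth_rewrite 1 [e5]
    have : ρ ^ (3 + α) ≠ 0 := by positivity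
    have : (1 + (g ρ / ρ) ^ 2) ^ ((3 + α) / 2) ≠ 0 := by positivity
    field_simp
  rw [e6, e3, e4, slopeKernel]
  field_simp
  ring

/-- Here `g` and `h` are the chord heights from the two base points, sharing the radial slope `a`.
As `g ≥ h`, the kernel terms have a favourable sign, and only the boundary terms of the integration
by parts remain. -/
theorem ray_integral_le {α a L K r R : ℝ} (hα : 0 ≤ α) (hL : (5 + α) * L ^ 2 ≤ 1 + α)
    (ha : |a| ≤ L) (hr : 0 < r) (hrR : r ≤ R) {g h g' h' : ℝ → ℝ}
    (hg : ∀ ρ, HasDerivAt g (g' ρ) ρ) (hh : ∀ ρ, HasDerivAt h (h' ρ) ρ)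
    (hg' : Continuous g') (hh' : Continuous h')
    (hgL : ∀ ρ, 0 < ρ → |g ρ| ≤ L * ρ) (hhL : ∀ ρ, 0 < ρ → |h ρ| ≤ L * ρ)
    (hle : ∀ ρ, h ρ ≤ g ρ) (hK : g r - h r ≤ K * r ^ 2) :
    ∫ ρ in r..R, (ρ ^ 2 * (a - g' ρ) / (ρ ^ 2 + g ρ ^ 2) ^ ((3 + α) / 2)
      - ρ ^ 2 * (a - h' ρ) / (ρ ^ 2 + h ρ ^ 2) ^ ((3 + α) / 2)) ≤ K * r ^ (1 - α) := by
  set p := (3 + α) / 2 with hp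
  have hslope : ∀ {k : ℝ → ℝ}, (∀ ρ, 0 < ρ → |k ρ| ≤ L * ρ) → ∀ ρ, 0 < ρ →
      k ρ / ρ ∈ Icc (-L) L := by
    intro k hk ρ hρ
    rw [mem_Icc, ← abs_le, abs_div, abs_of_pos hρ, div_le_iff₀ hρ]
    exact hk ρ hρ
  have hcont : ∀ {k k' : ℝ → ℝ}, (∀ ρ, HasDerivAt k (k' ρ) ρ) → Continuous k' →
      ContinuousOn (fun ρ => ρ ^ 2 * (a - k' ρ) / (ρ ^ 2 + k ρ ^ 2) ^ p) (Icc r R) := by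
    intro k k' hk hk'
    have hkc : Continuous k := continuous_iff_continuousAt.2 fun ρ => (hk ρ).continuousAt
    have hpos : ∀ ρ ∈ Icc r R, 0 < ρ ^ 2 + k ρ ^ 2 := fun ρ hρ => by
      have := hr.trans_le hρ.1
      positivity
    refine ContinuousOn.div (by fun_prop) (ContinuousOn.rpow_const (by fun_prop) fun ρ hρ => ?_)
      fun ρ hρ => (Real.rpow_pos_of_pos (hpos ρ hρ) _).ne'
    exact Or.inl (hpos ρ hρ).ne'
  have hderiv : ∀ ρ : ℝ, 0 < ρ → _ := fun ρ hρ =>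
    (hasDerivAt_rpow_mul_slopePrimitive (α := α) (a := a) hρ (hh ρ)).sub
      (hasDerivAt_rpow_mul_slopePrimitive (α := α) (a := a) hρ (hg ρ))
  have key := intervalIntegral.integral_le_sub_of_hasDeriv_right_of_le hrR
    (fun ρ hρ => (hderiv ρ (hr.trans_le hρ.1)).continuousAt.continuousWithinAt)
    (fun ρ hρ => (hderiv ρ (hr.trans hρ.1)).hasDerivWithinAt)
    (((hcont hg hg').sub (hcont hh hh')).integrableOn_Icc) (fun ρ hρ => by
      have hρ0 := hr.trans hρ.1
      have h1 := antitoneOn_slopeKernel hα hL ha (hslope hhL ρ hρ0) (hslope hgL ρ hρ0)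
        (div_le_div_of_nonneg_right (hle ρ) hρ0.le)
      have h2 : 0 ≤ ρ ^ (-1 - α) := by positivity
      have h3 := mul_le_mul_of_nonneg_left h1 h2
      simp only [Pi.sub_apply]
      linarith)
  refine key.trans ?_
  simp only [Pi.sub_apply]
  have hR0 := hr.trans_le hrR
  -- The boundary term at `R` can be dropped by sign; the one at `r` is small because the two slopes
  -- differ there by at most `K r`.
  have h4 : R ^ (-α) * slopePrimitive p (h R / R) ≤ R ^ (-α) * slopePrimitive p (g R / R) :=
    mul_le_mul_of_nonneg_left (monotone_slopePrimitive p
      (div_le_div_of_nonneg_right (hle R) hR0.le)) (by positivity)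
  have h5 := slopePrimitive_sub_le (p := p) (by rw [hp]; linarith)
    (div_le_div_of_nonneg_right (hle r) hr.le)
  have h6 : g r / r - h r / r ≤ K * r := by
    rw [← sub_div, div_le_iff₀ hr]; linarith [hK, sq r]
  have h7 := mul_le_mul_of_nonneg_left (h5.trans h6) (show 0 ≤ r ^ (-α) by positivity)
  have h8 : r ^ (1 - α) = r ^ (-α) * r := by
    rw [← Real.rpow_add_one hr.ne']; congr 1; ring
  rw [h8]
  linarith

/-! ### Polar coordinates and comparison of the principal values. -/

/-- A bound on the integrals along rays gives a bound on the integral over an annulus. -/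
theorem setIntegral_annulus_le {d : Plane → ℝ} {r R B : ℝ} (hr : 0 < r) (hrR : r ≤ R)
    (hd : IntegrableOn d {y | r < ‖y‖ ∧ ‖y‖ < R})
    (hB : ∀ ω : Plane, ‖ω‖ = 1 → ∫ ρ in r..R, ρ * d (ρ • ω) ≤ B) :
    ∫ y in {y : Plane | r < ‖y‖ ∧ ‖y‖ < R}, d y
      ≤ B * (volume : Measure Plane).toSphere.real univ := by
  set A : Set Plane := {y | r < ‖y‖ ∧ ‖y‖ < R} with hA
  have hAm : MeasurableSet A :=
    ((isOpen_lt continuous_const continuous_norm).inter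
      (isOpen_lt continuous_norm continuous_const)).measurableSet
  set e : Plane → ℝ := A.indicator d with he
  have hei : Integrable e := hd.integrable_indicator hAm
  have hmp := (volume : Measure Plane).measurePreserving_homeomorphUnitSphereProd
  have hemb := Homeomorph.measurableEmbedding (homeomorphUnitSphereProd Plane)
  set q : Metric.sphere (0 : Plane) 1 × Ioi (0 : ℝ) → ℝ := fun z => e (z.2.1 • z.1.1) with hq
  have hqc : ∀ y : ({0}ᶜ : Set Plane), q (homeomorphUnitSphereProd Plane y) = e y := by
    intro y
    have hy : ‖(y : Plane)‖ ≠ 0 := norm_ne_zero_iff.2 y.2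
    simp [hq, smul_smul, hy]
  have hqi : Integrable q ((volume : Measure Plane).toSphere.prod
      (.volumeIoiPow (Module.finrank ℝ Plane - 1))) := by
    rw [← hmp.integrable_comp_emb hemb]
    have : q ∘ homeomorphUnitSphereProd Plane = e ∘ Subtype.val := funext hqc
    rw [this, ← integrableOn_iff_comap_subtypeVal (measurableSet_singleton _).compl]
    exact hei.integrableOn
  have h1 : ∫ y in A, d y = ∫ z, q z ∂((volume : Measure Plane).toSphere.prod
      (.volumeIoiPow (Module.finrank ℝ Plane - 1))) := by
    rw [← integral_indicator hAm, ← hmp.integral_comp hemb]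
    simp only [hqc]
    rw [integral_subtype_comap (measurableSet_singleton _).compl e,
      restrict_compl_singleton]
  have h2 : ∀ ω : Metric.sphere (0 : Plane) 1,
      ∫ ρ, q (ω, ρ) ∂(Measure.volumeIoiPow (Module.finrank ℝ Plane - 1)) ≤ B := by
    intro ω
    have hω : ‖(ω : Plane)‖ = 1 := by simp
    have h3 : ∫ ρ, q (ω, ρ) ∂(Measure.volumeIoiPow (Module.finrank ℝ Plane - 1))
        = ∫ ρ in Ioi (0 : ℝ), ρ * e (ρ • (ω : Plane)) := by
      simp only [Measure.volumeIoiPow, ENNReal.ofReal]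
      rw [integral_withDensity_eq_integral_smul
        ((measurable_subtype_coe.pow_const _).real_toNNReal),
        integral_subtype_comap measurableSet_Ioi fun a : ℝ =>
          Real.toNNReal (a ^ (Module.finrank ℝ Plane - 1)) • e (a • (ω : Plane))]
      refine setIntegral_congr_fun measurableSet_Ioi fun x hx => ?_
      simp only [finrank_euclideanSpace_fin, NNReal.smul_def]
      rw [Real.coe_toNNReal _ (pow_nonneg (le_of_lt hx) _)]
      simp
    have h4 : ∫ ρ in Ioi (0 : ℝ), ρ * e (ρ • (ω : Plane))
        = ∫ ρ in r..R, ρ * d (ρ • (ω : Plane)) := by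
      rw [intervalIntegral.integral_of_le hrR, ← integral_Ioc_eq_integral_Ioo.symm,
        ← integral_indicator measurableSet_Ioi, ← integral_indicator measurableSet_Ioo]
      congr 1
      ext ρ
      by_cases hρ : 0 < ρ
      · have hn : ‖ρ • (ω : Plane)‖ = ρ := by rw [norm_smul, hω, mul_one, Real.norm_of_nonneg hρ.le]
        by_cases h5 : ρ ∈ Ioo r R
        · have : ρ • (ω : Plane) ∈ A := by rw [hA, mem_ofPred_eq, hn]; exact h5
          simp [he, this, h5, hρ]
        · have : ρ • (ω : Plane) ∉ A := by rw [hA, mem_ofPred_eq, hn]; exact h5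
          simp [he, this, h5]
      · have h5 : ρ ∉ Ioo r R := fun h => hρ (hr.trans h.1)
        simp [h5, hρ]
    rw [h3, h4]
    exact hB ω hω
  rw [h1, integral_prod _ hqi]
  refine (integral_mono hqi.integral_prod_left (integrable_const B) h2).trans_eq ?_
  rw [integral_const, smul_eq_mul, mul_comm]

theorem abs_sub_sub_inner_gradient_le {φ : Plane → ℝ} {K : ℝ} (hφ : Differentiable ℝ φ)
    (hK0 : 0 ≤ K) (hK : ∀ x y, ‖∇ φ x - ∇ φ y‖ ≤ K * ‖x - y‖) (x y : Plane) :
    |φ x - φ (x - y) - inner ℝ (∇ φ x) y| ≤ K * ‖y‖ ^ 2 := by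
  have hf : ∀ w, HasFDerivAt φ (InnerProductSpace.toDual ℝ Plane (∇ φ w)) w := fun w =>
    (hφ w).hasGradientAt.hasFDerivAt
  have h := Convex.norm_image_sub_le_of_norm_hasFDerivWithin_le' (𝕜 := ℝ)
    (s := Metric.closedBall x ‖y‖) (C := K * ‖y‖) (x := x) (y := x - y)
    (φ := InnerProductSpace.toDual ℝ Plane (∇ φ x))
    (fun w _ => (hf w).hasFDerivWithinAt) (fun w hw => by
      rw [← map_sub, LinearIsometryEquiv.norm_map]
      refine (hK w x).trans ?_
      gcongr
      rwa [← dist_eq_norm]) (convex_closedBall _ _) (by simp) (by simp)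
  have e : x - y - x = -y := by abel
  rw [e, map_neg, norm_neg, InnerProductSpace.toDual_apply_apply, Real.norm_eq_abs] at h
  rw [← abs_neg]
  refine le_trans (le_of_eq ?_) (h.trans_eq (by ring))
  congr 1; ring

theorem abs_sub_le_of_norm_gradient_le {φ : Plane → ℝ} {L : ℝ} (hφ : Differentiable ℝ φ)
    (hL : ∀ x, ‖∇ φ x‖ ≤ L) (x y : Plane) : |φ x - φ y| ≤ L * ‖x - y‖ := by
  have hf : ∀ w, HasFDerivAt φ (InnerProductSpace.toDual ℝ Plane (∇ φ w)) w := fun w =>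
    (hφ w).hasGradientAt.hasFDerivAt
  exact Convex.norm_image_sub_le_of_norm_hasFDerivWithin_le (𝕜 := ℝ) (s := univ)
    (fun w _ => (hf w).hasFDerivWithinAt) (fun w _ => by
      rw [LinearIsometryEquiv.norm_map]; exact hL w) convex_univ (mem_univ y) (mem_univ x)

theorem integral_annulus_contourIntegrand_sub_le {α L K r R : ℝ} (hα : 0 ≤ α)
    (hL : (5 + α) * L ^ 2 ≤ 1 + α) {φ : Plane → ℝ} (hφ : Differentiable ℝ φ)
    (hK0 : 0 ≤ K) (hK : ∀ x y, ‖∇ φ x - ∇ φ y‖ ≤ K * ‖x - y‖) (hgrad : ∀ x, ‖∇ φ x‖ ≤ L)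
    {x z : Plane} (heq : ∇ φ z = ∇ φ x) (hmax : ∀ y, φ (z - y) - φ (x - y) ≤ φ z - φ x)
    (hr : 0 < r) (hrR : r ≤ R)
    (hx : IntegrableOn (contourIntegrand α φ x) {y | r < ‖y‖ ∧ ‖y‖ < R})
    (hz : IntegrableOn (contourIntegrand α φ z) {y | r < ‖y‖ ∧ ‖y‖ < R}) :
    (∫ y in {y : Plane | r < ‖y‖ ∧ ‖y‖ < R}, contourIntegrand α φ z y)
      - ∫ y in {y : Plane | r < ‖y‖ ∧ ‖y‖ < R}, contourIntegrand α φ x y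
      ≤ 2 * K * r ^ (1 - α) * (volume : Measure Plane).toSphere.real univ := by
  rw [← integral_sub hz hx]
  refine setIntegral_annulus_le hr hrR (hz.sub hx) fun ω hω => ?_
  have hgc : Continuous (∇ φ) :=
    (LipschitzWith.of_dist_le_mul (K := ⟨K, hK0⟩) fun x y => by
      rw [dist_eq_norm, dist_eq_norm]; exact hK x y).continuous
  have hd : ∀ w ρ, HasDerivAt (fun ρ : ℝ => φ w - φ (w - ρ • ω))
      (inner ℝ (∇ φ (w - ρ • ω)) ω) ρ := by
    intro w ρ
    have h1 : HasDerivAt (fun ρ : ℝ => w - ρ • ω) (-ω) ρ := by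
      simpa using ((hasDerivAt_id ρ).smul_const ω).const_sub w
    have h2 := ((hφ (w - ρ • ω)).hasGradientAt.hasFDerivAt.comp_hasDerivAt ρ h1).const_sub (φ w)
    simpa [InnerProductSpace.toDual_apply_apply] using h2
  have hc : ∀ w, Continuous fun ρ : ℝ => inner ℝ (∇ φ (w - ρ • ω)) ω := fun w => by fun_prop
  have hbd : ∀ w ρ, 0 < ρ → |φ w - φ (w - ρ • ω)| ≤ L * ρ := by
    intro w ρ hρ
    refine (abs_sub_le_of_norm_gradient_le hφ hgrad _ _).trans_eq ?_
    rw [sub_sub_cancel, norm_smul, hω, mul_one, Real.norm_of_nonneg hρ.le]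
  have ha : |inner ℝ (∇ φ x) ω| ≤ L := by
    refine (abs_real_inner_le_norm _ _).trans ?_
    rw [hω, mul_one]; exact hgrad x
  have hn : ‖r • ω‖ = r := by rw [norm_smul, hω, mul_one, Real.norm_of_nonneg hr.le]
  -- The linear Taylor terms cancel since the gradients agree; each of the two remainders is at most
  -- `K r²`.
  have hT : (φ z - φ (z - r • ω)) - (φ x - φ (x - r • ω)) ≤ 2 * K * r ^ 2 := by
    have h1 := (abs_le.1 (abs_sub_sub_inner_gradient_le hφ hK0 hK z (r • ω))).2
    have h2 := (abs_le.1 (abs_sub_sub_inner_gradient_le hφ hK0 hK x (r • ω))).1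
    rw [heq, hn] at h1
    rw [hn] at h2
    linarith
  have key := ray_integral_le hα hL ha hr hrR (hd z) (hd x) (hc z) (hc x) (hbd z) (hbd x)
    (fun ρ => by have := hmax (ρ • ω); linarith) hT
  refine le_trans (le_of_eq ?_) key
  congr 1
  ext ρ
  have hn2 : ‖ρ • ω‖ ^ 2 = ρ ^ 2 := by rw [norm_smul, hω, mul_one, Real.norm_eq_abs, sq_abs]
  simp only [contourIntegrand, inner_smul_right, inner_sub_left, hn2, heq]
  ring

/-- Comparison of the right-hand side of the contour equation at two points at which the gradients
agree and whose increment is maximal. -/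
theorem pv_le_pv {α L K : ℝ} (hα : 0 ≤ α) (hα₁ : α < 1)
    (hL : (5 + α) * L ^ 2 ≤ 1 + α) {φ : Plane → ℝ} (hφ : Differentiable ℝ φ)
    (hK0 : 0 ≤ K) (hK : ∀ x y, ‖∇ φ x - ∇ φ y‖ ≤ K * ‖x - y‖) (hgrad : ∀ x, ‖∇ φ x‖ ≤ L)
    {x z : Plane} (heq : ∇ φ z = ∇ φ x) (hmax : ∀ y, φ (z - y) - φ (x - y) ≤ φ z - φ x)
    {v w : ℝ} (hx : HasPV (contourIntegrand α φ x) v) (hz : HasPV (contourIntegrand α φ z) w) :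
    w ≤ v := by
  -- The inner boundary error vanishes as `r → 0⁺` because `α < 1`.
  have h1 : Tendsto (fun r : ℝ => 2 * K * r ^ (1 - α) * (volume : Measure Plane).toSphere.real univ)
      (𝓝[>] 0) (𝓝 0) := by
    have : Tendsto (fun r : ℝ => r ^ (1 - α)) (𝓝[>] 0) (𝓝 0) := by
      have := (Real.continuousAt_rpow_const 0 (1 - α) (Or.inr (by linarith))).tendsto
      rw [Real.zero_rpow (by linarith)] at this
      exact this.mono_left nhdsWithin_le_nhds
    simpa using (this.const_mul (2 * K)).mul_const ((volume : Measure Plane).toSphere.real univ)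
  have h2 := le_of_tendsto_of_tendsto (hz.2.sub hx.2)
    (h1.comp (tendsto_fst (g := (atTop : Filter ℝ)))) (by
      have hev : ∀ᶠ p : ℝ × ℝ in 𝓝[>] 0 ×ˢ atTop, p.1 ∈ Ioo (0 : ℝ) 1 ∧ (1 : ℝ) ≤ p.2 :=
        Filter.Eventually.prod_mk (Ioo_mem_nhdsGT one_pos) (eventually_ge_atTop 1)
      filter_upwards [hev] with p hp
      exact integral_annulus_contourIntegrand_sub_le hα hL hφ hK0 hK hgrad heq hmax hp.1.1
        (hp.1.2.le.trans hp.2) (hx.1 _ _ hp.1.1) (hz.1 _ _ hp.1.1))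
  linarith

/-! ### Maximum principle in time. -/

/-- A maximum principle: if the time derivative is nonpositive at every spatial maximum point, then
the spatial maximum does not increase. -/
theorem le_of_deriv_nonpos_at_max {X H : Type*} [TopologicalSpace X] [NoncompactSpace X]
    [NormedAddCommGroup H] {q : ℝ → X → ℝ} {F : ℝ → H} {a b C M : ℝ} (hab : a ≤ b)
    (hq : ∀ t ∈ Icc a b, Continuous (q t))
    (h0 : ∀ t ∈ Icc a b, Tendsto (q t) (cocompact X) (𝓝 0))
    (hbd : ∀ t ∈ Icc a b, BddAbove (range (q t)))
    (hF : ContinuousOn F (Icc a b))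
    (hqF : ∀ s ∈ Icc a b, ∀ t ∈ Icc a b, ∀ x, |q s x - q t x| ≤ C * ‖F s - F t‖)
    (hd : ∀ t ∈ Ioc a b, ∀ x, (∀ y, q t y ≤ q t x) →
      ∃ v ≤ 0, HasDerivWithinAt (fun s => q s x) v (Icc a b) t)
    (ha : ∀ x, q a x ≤ M) (x : X) : q b x ≤ M := by
  have : Nonempty X := ⟨x⟩
  set D : ℝ → ℝ := fun t => ⨆ y, q t y with hD
  have hle : ∀ t ∈ Icc a b, ∀ y, q t y ≤ D t := fun t ht y => le_ciSup (hbd t ht) y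
  have hD0 : ∀ t ∈ Icc a b, 0 ≤ D t := fun t ht =>
    le_of_tendsto (h0 t ht) (Eventually.of_forall (hle t ht))
  have hDle : ∀ s ∈ Icc a b, ∀ t ∈ Icc a b, D s - D t ≤ C * ‖F s - F t‖ := by
    intro s hs t ht
    have : D s ≤ D t + C * ‖F s - F t‖ := ciSup_le fun y => by
      have h1 := (abs_le.1 (hqF s hs t ht y)).2
      have h2 := hle t ht y
      linarith
    linarith
  have hDc : ContinuousOn D (Icc a b) := by
    intro t ht
    have h1 : Tendsto (fun s => C * ‖F s - F t‖) (𝓝[Icc a b] t) (𝓝 0) := by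
      have h2 : Tendsto (fun s => F s - F t) (𝓝[Icc a b] t) (𝓝 0) := by
        simpa using (hF t ht).tendsto.sub_const (F t)
      simpa using h2.norm.const_mul C
    refine tendsto_iff_dist_tendsto_zero.2 (squeeze_zero' (Eventually.of_forall fun s => dist_nonneg)
      ?_ h1)
    filter_upwards [self_mem_nhdsWithin] with s hs
    rw [Real.dist_eq, abs_le]
    have h3 := hDle t ht s hs
    rw [norm_sub_rev] at h3
    exact ⟨by linarith, hDle s hs t ht⟩
  have hmaps : MapsTo (fun s => b - s) (Icc 0 (b - a)) (Icc a b) := fun s hs =>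
    ⟨by linarith [hs.2], by linarith [hs.1]⟩
  -- Time is reversed: a maximum point at time `t` bounds `D` from below at earlier times, hence
  -- controls the backward difference quotients of `D`.
  have key := image_le_of_liminf_slope_right_le_deriv_boundary (f := fun s => -D (b - s))
    (a := 0) (b := b - a) (B := fun _ => -D b) (B' := fun _ => 0)
    (hDc.comp (by fun_prop) hmaps).neg (by simp) continuousOn_const
    (fun s _ => hasDerivWithinAt_const _ _ _) (fun s hs ε hε => by
      refine Eventually.frequently ?_
      set t := b - s with ht
      have htI : t ∈ Ioc a b := ⟨by rw [ht]; linarith [hs.2], by rw [ht]; linarith [hs.1]⟩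
      have htI' := Ioc_subset_Icc_self htI
      have hI : Ioo s (b - a) ∈ 𝓝[>] s := Ioo_mem_nhdsGT hs.2
      have hz : ∀ z ∈ Ioo s (b - a), b - z ∈ Icc a b := fun z hz =>
        ⟨by linarith [hz.2], by linarith [hz.1, hs.1]⟩
      -- Decay at infinity makes `D ≥ 0`. If `D t = 0` the quotient has the right sign at once; if
      -- `D t > 0` the supremum is attained.
      rcases (hD0 t htI').eq_or_lt with hDt | hDt
      · filter_upwards [hI] with z hzI
        refine lt_of_le_of_lt ?_ hε
        rw [slope_def_field, ← ht, ← hDt]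
        have := hD0 _ (hz z hzI)
        exact div_nonpos_of_nonpos_of_nonneg (by linarith) (by linarith [hzI.1])
      · obtain ⟨x₀, hx₀⟩ : ∃ y, 0 < q t y := by
          by_contra! hcon
          exact absurd (ciSup_le hcon) (not_le.2 hDt)
        obtain ⟨x₁, hx₁⟩ := (hq t htI').exists_forall_ge' x₀
          (((h0 t htI').eventually (gt_mem_nhds hx₀)).mono fun _ h => le_of_lt h)
        have hDx : D t = q t x₁ := le_antisymm (ciSup_le hx₁) (hle t htI' x₁)
        obtain ⟨v, hv, hder⟩ := hd t htI x₁ hx₁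
        have h1 : HasDerivWithinAt (fun r => b - r) (-1) (Ioi s) s := by
          simpa using ((hasDerivAt_id s).const_sub b).hasDerivWithinAt
        have h2 : HasDerivWithinAt (fun r => -q (b - r) x₁) v (Ioo s (b - a)) s := by
          have h3 := (HasDerivWithinAt.comp (h₂ := fun r => q r x₁) s hder
            (h1.mono (fun z (h : z ∈ Ioo s (b - a)) => h.1)) hz).neg
          rw [mul_neg_one, neg_neg] at h3
          exact h3
        rw [hasDerivWithinAt_iff_tendsto_slope' (fun h => lt_irrefl _ h.1),
          nhdsWithin_Ioo_eq_nhdsGT hs.2] at h2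
        filter_upwards [h2.eventually (gt_mem_nhds (hv.trans_lt hε)), hI] with z hzs hzI
        refine lt_of_le_of_lt ?_ hzs
        rw [slope_def_field, slope_def_field, ← ht, hDx]
        have := hle _ (hz z hzI) x₁
        exact div_le_div_of_nonneg_right (by linarith) (by linarith [hzI.1]))
  have h := key (right_mem_Icc.2 (by linarith))
  simp only [sub_sub_cancel] at h
  have hDa : D a ≤ M := ciSup_le ha
  have := hle b (right_mem_Icc.2 hab) x
  linarith

/-! ### Propagation of the gradient bound along the solution. -/

theorem gradient_fun_sub {φ ψ : Plane → ℝ} (hφ : Differentiable ℝ φ) (hψ : Differentiable ℝ ψ)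
    (x : Plane) : ∇ (fun y => φ y - ψ y) x = ∇ φ x - ∇ ψ x := by
  simp only [gradient]
  rw [fderiv_fun_sub (hφ x) (hψ x), map_sub]

theorem gradient_eq_of_isMax_increment {φ : Plane → ℝ} (hφ : Differentiable ℝ φ) {ξ x : Plane}
    (h : ∀ y, φ (y + ξ) - φ y ≤ φ (x + ξ) - φ x) : ∇ φ (x + ξ) = ∇ φ x := by
  have h1 : IsLocalMax (fun y => φ (y + ξ) - φ y) x := Eventually.of_forall h
  have h2 : HasFDerivAt (fun y => φ (y + ξ) - φ y) (fderiv ℝ φ (x + ξ) - fderiv ℝ φ x) x :=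
    ((hasFDerivAt_comp_add_right ξ).2 (hφ (x + ξ)).hasFDerivAt).sub (hφ x).hasFDerivAt
  have h3 := h1.hasFDerivAt_eq_zero h2
  simp only [gradient]
  rw [sub_eq_zero.1 h3]

/-- Increments of a solution do not increase as long as the gradient stays below the threshold. -/
theorem IsSolution.increment_le {α T : ℝ} {k : ℕ} {f₀ : Plane → ℝ} {f : ℝ → Plane → ℝ}
    (hf : IsSolution α k T f₀ f) (hk : 4 ≤ k) (hα : 0 ≤ α) (hα₁ : α < 1) {a b L M : ℝ}
    (hab : a ≤ b) (hT : Icc a b ⊆ Icc 0 T) (hL : (5 + α) * L ^ 2 ≤ 1 + α)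
    (hgrad : ∀ t ∈ Icc a b, ∀ x, ‖∇ (f t) x‖ ≤ L) {ξ : Plane}
    (ha : ∀ x, f a (x + ξ) - f a x ≤ M) (x : Plane) : f b (x + ξ) - f b x ≤ M := by
  obtain ⟨F, hF, hfF⟩ := hf.c1_curve
  set C := 2 * Real.pi * (eLpNorm japaneseWeight 2 (volume : Measure Plane)).toReal with hC
  have hs : ∀ t ∈ Icc a b, _ := fun t ht => (hfF t (hT ht)).sobolev hk (hf.continuous t (hT ht))
  refine le_of_deriv_nonpos_at_max (q := fun t x => f t (x + ξ) - f t x) (F := F) (C := 2 * C) hab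
    (fun t ht => ?_) (fun t ht => ?_) (fun t ht => ?_) (hF.continuousOn.mono hT)
    (fun s hs' t ht x => ?_) (fun t ht x hmax => ?_) ha x
  · have := hf.continuous t (hT ht)
    fun_prop
  · have h1 := (hs t ht).2.1
    have h2 := h1.comp (Homeomorph.addRight ξ).isClosedEmbedding.tendsto_cocompact
    simpa using h2.sub h1
  · refine ⟨2 * (C * ‖F t‖), ?_⟩
    rintro _ ⟨y, rfl⟩
    have h1 := (abs_le.1 ((hs t ht).2.2.2.1 (y + ξ))).2
    have h2 := (abs_le.1 ((hs t ht).2.2.2.1 y)).1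
    show f t (y + ξ) - f t y ≤ _
    linarith
  -- The embedding is applied to `f s - f t`, whose Bessel potential is `F s - F t`; evaluating at
  -- the two points `x+ξ` and `x` gives the factor 2.
  · have h := ((hfF s (hT hs')).sub (hfF t (hT ht))).sobolev hk
      ((hf.continuous s (hT hs')).sub (hf.continuous t (hT ht)))
    have h1 := abs_le.1 (h.2.2.2.1 (x + ξ))
    have h2 := abs_le.1 (h.2.2.2.1 x)
    rw [Pi.sub_apply] at h1 h2
    rw [abs_le]
    constructor <;> linarith [h1.1, h1.2, h2.1, h2.2]
  · have htI := Ioc_subset_Icc_self ht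
    obtain ⟨hd, -, ⟨K, hK0, hK⟩, -⟩ := hs t htI
    obtain ⟨v, hv, hpv⟩ := hf.equation t (hT htI) x
    obtain ⟨w, hw, hpw⟩ := hf.equation t (hT htI) (x + ξ)
    refine ⟨w - v, sub_nonpos.2 ?_, (hw.sub hv).mono hT⟩
    refine pv_le_pv hα hα₁ hL hd hK0 hK (hgrad t htI) (gradient_eq_of_isMax_increment hd hmax)
      (fun y => ?_) hpv hpw
    have := hmax (x - y)
    rwa [sub_add_eq_add_sub] at this

theorem norm_gradient_le_of_increment_le {φ : Plane → ℝ} {L : ℝ} (hL : 0 ≤ L)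
    (h : ∀ ξ x, φ (x + ξ) - φ x ≤ L * ‖ξ‖) (x : Plane) : ‖∇ φ x‖ ≤ L := by
  have hl : LipschitzWith ⟨L, hL⟩ φ := LipschitzWith.of_dist_le_mul fun y z => by
    rw [Real.dist_eq, abs_le, dist_eq_norm]
    have h1 := h (y - z) z
    have h2 := h (z - y) y
    rw [norm_sub_rev] at h2
    simp only [add_sub_cancel] at h1 h2
    exact ⟨by change -(L * ‖y - z‖) ≤ _; linarith, h1⟩
  rw [gradient, LinearIsometryEquiv.norm_map]
  exact norm_fderiv_le_of_lipschitz ℝ hl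

/-- Continuous induction on the set of times at which the bound `L` holds: it is closed by
continuity of the gradient in time, and the room between `L` and the threshold lets it be extended
to the right. -/
theorem IsSolution.norm_gradient_le {α T : ℝ} {k : ℕ} {f₀ : Plane → ℝ} {f : ℝ → Plane → ℝ}
    (hf : IsSolution α k T f₀ f) (hk : 4 ≤ k) (hα : 0 ≤ α) (hα₁ : α < 1) {L : ℝ} (hL0 : 0 ≤ L)
    (hL : (5 + α) * L ^ 2 < 1 + α) (h0 : ∀ x, ‖∇ f₀ x‖ ≤ L) :
    ∀ t ∈ Icc 0 T, ∀ x, ‖∇ (f t) x‖ ≤ L := by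
  obtain ⟨F, hF, hfF⟩ := hf.c1_curve
  set C := 2 * Real.pi * (eLpNorm japaneseWeight 2 (volume : Measure Plane)).toReal with hC
  have hC0 : 0 ≤ C := by positivity
  have hs : ∀ t ∈ Icc 0 T, _ := fun t ht => (hfF t ht).sobolev hk (hf.continuous t ht)
  have hcont : ∀ s ∈ Icc 0 T, ∀ t ∈ Icc 0 T, ∀ x,
      ‖∇ (f s) x - ∇ (f t) x‖ ≤ C * ‖F s - F t‖ := by
    intro s hs' t ht x
    rw [← gradient_fun_sub (hs s hs').1 (hs t ht).1]
    exact (((hfF s hs').sub (hfF t ht)).sobolev hk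
      ((hf.continuous s hs').sub (hf.continuous t ht))).2.2.2.2 x
  have hFt : ∀ t ∈ Icc 0 T, Tendsto (fun s => C * ‖F s - F t‖) (𝓝[Icc 0 T] t) (𝓝 0) := by
    intro t ht
    have h2 : Tendsto (fun s => F s - F t) (𝓝[Icc 0 T] t) (𝓝 0) := by
      simpa using (hF.continuousOn t ht).tendsto.sub_const (F t)
    simpa using h2.norm.const_mul C
  have hgc : ∀ x, ContinuousOn (fun t => ‖∇ (f t) x‖) (Icc 0 T) := by
    intro x
    refine ContinuousOn.norm fun t ht => ?_
    refine tendsto_iff_norm_sub_tendsto_zero.2 (squeeze_zero'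
      (Eventually.of_forall fun s => norm_nonneg _) ?_ (hFt t ht))
    filter_upwards [self_mem_nhdsWithin] with s hs'
    exact hcont s hs' t ht x
  obtain ⟨Λ, hLΛ, hΛ⟩ : ∃ Λ, L < Λ ∧ (5 + α) * Λ ^ 2 ≤ 1 + α := by
    have h1 : ContinuousAt (fun l : ℝ => (5 + α) * l ^ 2) L := by fun_prop
    have h2 : ∀ᶠ l in 𝓝[>] L, (5 + α) * l ^ 2 < 1 + α :=
      nhdsWithin_le_nhds (h1.eventually (gt_mem_nhds hL))
    obtain ⟨Λ, h3, h4⟩ := (h2.and self_mem_nhdsWithin).exists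
    exact ⟨Λ, h4, h3.le⟩
  refine IsClosed.Icc_subset_of_forall_exists_gt (s := {t | ∀ x, ‖∇ (f t) x‖ ≤ L}) ?_
    (fun x => by rw [hf.initial]; exact h0 x) ?_
  · have : {t | ∀ x, ‖∇ (f t) x‖ ≤ L} ∩ Icc 0 T
        = ⋂ x : Plane, Icc 0 T ∩ (fun t => ‖∇ (f t) x‖) ⁻¹' Iic L := by
      ext t
      simp only [mem_inter_iff, mem_ofPred_eq, mem_iInter, mem_preimage, mem_Iic]
      exact ⟨fun h x => ⟨h.2, h.1 x⟩, fun h => ⟨fun x => (h x).2, (h 0).1⟩⟩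
    rw [this]
    exact isClosed_iInter fun x => (hgc x).preimage_isClosed_of_isClosed isClosed_Icc isClosed_Iic
  · rintro t ⟨htL, htI⟩ y hy
    have htI' := Ico_subset_Icc_self htI
    have h1 : ∀ᶠ s in 𝓝[Icc 0 T] t, C * ‖F s - F t‖ < Λ - L :=
      (hFt t htI').eventually (gt_mem_nhds (by linarith))
    obtain ⟨δ, hδ, hball⟩ := Metric.mem_nhdsWithin_iff.1 h1
    set b := min (min y T) (t + δ / 2) with hb
    have htb : t < b := lt_min (lt_min hy htI.2) (by linarith)
    have hby : b ≤ y := (min_le_left _ _).trans (min_le_left _ _)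
    have hbT : b ≤ T := (min_le_left _ _).trans (min_le_right _ _)
    have hbδ : b ≤ t + δ / 2 := min_le_right _ _
    have hsub : Icc t b ⊆ Icc 0 T := Icc_subset_Icc htI.1 hbT
    refine ⟨b, ?_, htb, hby⟩
    have hgΛ : ∀ s ∈ Icc t b, ∀ x, ‖∇ (f s) x‖ ≤ Λ := by
      intro s hs' x
      have h2 : s ∈ Metric.ball t δ ∩ Icc 0 T := by
        refine ⟨?_, hsub hs'⟩
        rw [Metric.mem_ball, Real.dist_eq, abs_of_nonneg (by linarith [hs'.1])]
        linarith [hs'.2]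
      have h3 : C * ‖F s - F t‖ < Λ - L := hball h2
      have h4 := hcont s h2.2 t htI' x
      have h5 := norm_le_norm_add_norm_sub' (∇ (f s) x) (∇ (f t) x)
      have h6 := htL x
      linarith
    -- The weaker bound `Λ` only serves to make the maximum principle applicable on `[t,b]`; the
    -- constant it propagates is the bound `L‖ξ‖` on increments at time `t`, so nothing is lost from
    -- step to step.
    refine norm_gradient_le_of_increment_le hL0 fun ξ x => ?_
    refine hf.increment_le hk hα hα₁ htb.le hsub hΛ hgΛ (fun x => ?_) x
    have h7 := abs_sub_le_of_norm_gradient_le (hs t htI').1 htL (x + ξ) x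
    rw [add_sub_cancel_left] at h7
    exact (le_abs_self _).trans h7

theorem norm_le_of_eLpNorm_top_le {g : Plane → Plane} (hg : Continuous g) {L : ℝ}
    (h : eLpNorm g ⊤ volume ≤ ENNReal.ofReal L) (hL : 0 ≤ L) (x : Plane) : ‖g x‖ ≤ L := by
  have h1 : ∀ᵐ y, ‖g y‖ ≤ L := by
    filter_upwards [enorm_ae_le_eLpNormEssSup g volume] with y hy
    rw [← eLpNorm_exponent_top] at hy
    have := hy.trans h
    rwa [← ofReal_norm, ENNReal.ofReal_le_ofReal_iff hL] at this
  have h2 : Dense {y | ‖g y‖ ≤ L} := Measure.dense_of_ae h1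
  have h3 : IsClosed {y | ‖g y‖ ≤ L} := isClosed_le hg.norm continuous_const
  have := h2.closure_eq
  rw [h3.closure_eq] at this
  have hx : x ∈ {y | ‖g y‖ ≤ L} := by rw [this]; exact mem_univ x
  exact hx

end Muskat

theorem mainTheorem5 (k : ℕ) (hk : 4 ≤ k) (f₀ : Muskat.Plane → ℝ) (hf₀ : Muskat.MemH k f₀)
    (α : ℝ) (hα₀ : 0 ≤ α) (hα₁ : α < 1) (ε : ℝ) (hε₀ : 0 < ε) (hε₁ : ε < 1 + α)
    (T : ℝ) (hT : 0 < T) (f : ℝ → Muskat.Plane → ℝ) (hf : Muskat.IsSolution α k T f₀ f)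
    (hsmall : eLpNorm (∇ f₀) ⊤ volume
      < ENNReal.ofReal (Real.sqrt ((1 + α - ε) / (5 + α + ε)))) :
    ∀ t ∈ Icc 0 T, eLpNorm (∇ (f t)) ⊤ volume ≤ eLpNorm (∇ f₀) ⊤ volume := by
  intro t ht
  have hne : eLpNorm (∇ f₀) ⊤ volume ≠ ⊤ := (hsmall.trans_le le_top).ne
  set L := (eLpNorm (∇ f₀) ⊤ volume).toReal with hLdef
  have hLeq : ENNReal.ofReal L = eLpNorm (∇ f₀) ⊤ volume := ENNReal.ofReal_toReal hne
  have hL0 : 0 ≤ L := ENNReal.toReal_nonneg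
  have h0T : (0 : ℝ) ∈ Icc 0 T := left_mem_Icc.2 hT.le
  obtain ⟨F, -, hfF⟩ := hf.c1_curve
  obtain ⟨-, -, ⟨K, hK0, hK⟩, -⟩ := (hfF 0 h0T).sobolev hk (hf.continuous 0 h0T)
  rw [hf.initial] at hK
  have hgc : Continuous (∇ f₀) :=
    (LipschitzWith.of_dist_le_mul (K := ⟨K, hK0⟩) fun x y => by
      rw [dist_eq_norm, dist_eq_norm]; exact hK x y).continuous
  -- Squaring the hypothesis gives `(5+α+ε)L² < 1+α-ε`; the terms in `ε` are then discarded.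
  have hlt : (5 + α) * L ^ 2 < 1 + α := by
    rw [← hLeq, ENNReal.ofReal_lt_ofReal_iff_of_nonneg hL0, Real.lt_sqrt hL0,
      lt_div_iff₀ (by linarith)] at hsmall
    nlinarith [sq_nonneg L]
  have key := hf.norm_gradient_le hk hα₀ hα₁ hL0 hlt
    (Muskat.norm_le_of_eLpNorm_top_le hgc hLeq.ge hL0) t ht
  rw [← hLeq, eLpNorm_exponent_top]
  refine eLpNormEssSup_le_of_ae_enorm_bound (ae_of_all _ fun x => ?_)
  rw [← ofReal_norm]
  exact ENNReal.ofReal_le_ofReal (key x)
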